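/- **Setting.** Let $N\ge 1$ agents act on $x[t+1]=Ax[t]+\sum_{i=1}^N B_iu_i[t]$, $x[t]\in\mathbb R^n$, $u_i[t]\in\mathbb R^m$, subject to $x[t]\in\mathbb X$ and $u_i[t]\in\mathbb U_i(\boldsymbol u_{-i}[t])$, with stage costs $\ell_i(x,u_i)=\tfrac12\|x\|_{Q_i}^2+\tfrac12\|u_i\|_{R_i}^2$. For a horizon $T\ge1$ let $\phi[t|x_0,\boldsymbol u]$ be the state at time $t$ from $x_0$ under $\boldsymbol u$, and let $\mathcal U_{i,T}(x_0,\boldsymbol u_{-i})$ be the set of $u_i=(u_i[0],\dots,u_i[T-1])$ with $u_i[t]\in\mathbb U_i(\boldsymbol u_{-i}[t])$ for $0\le t<T$ and $\phi[t|x_0,\boldsymbol u]\in\mathbb X$ for $1\le t\le T$. **Assumptions.** (1) $0\in\operatorname{int}\mathbb X$; $0\in\operatorname{int}\{\boldsymbol w\in\mathbb R^{Nm}: w_i\in\mathbb U_i(\boldsymbol w_{-i})\ \forall i\}$; $Q_i=C_i^\top C_i$ and $R_i=R_i^\top\succ0$ for all $i$. (2) $A$ is invertible, and for every $i$ the pair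 $(A,B_i)$ is stabilizable and $(A,C_i)$ is detectable. (3) With $S_j=B_jR_j^{-1}B_j^\top$, the matrix $$H=\begin{bmatrix}A+\sum_jS_jA^{-\top}Q_j&\operatorname{row}(-S_jA^{-\top})_j\\ \operatorname{col}(-A^{-\top}Q_j)_j&I_N\otimes A^{-\top}\end{bmatrix}$$ has exactly $n$ eigenvalues (with multiplicity) of modulus smaller than $1$, and its $n$-dimensional stable invariant subspace $W$ is complementary to $\operatorname{Im}\begin{bmatrix}0\\I_{Nn}\end{bmatrix}$. Let $(P_i,K_i)_i$ be the solution determined by $W$ of $P_i=Q_i+A^\top P_i\bar A$, $K_i=-R_i^{-1}B_i^\top P_i\bar A$, $\bar A=A+\sum_iB_iK_i$; that is, a solution for which the columns of $\operatorname{col}(I,P_1,\dots,P_N)$ lie in $W$. Let $\widehat P_i\succeq0$ solve $$\widehat P_i=\widehat Q_i+\widehat A_i^\top\widehat P_i(\widehat A_i+\widehat B_i\widehat K_i),\qquad \widehat K_i=-(R_i+\widehat B_i^\top\widehat P_i\widehat B_i)^{-1}\widehat B_i^\top\widehat P_i\widehat A_i,$$ $$\widehat A_i=\begin{bmatrix}A&\sum_{j\ne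 i}B_jK_j\\0&\bar A\end{bmatrix},\quad \widehat B_i=\begin{bmatrix}B_i\\0\end{bmatrix},\quad \widehat Q_i=\begin{bmatrix}Q_i&0\\0&0\end{bmatrix},$$ and put $V_i(x,y)=\tfrac12\begin{bmatrix}x\\y\end{bmatrix}^{\top}\widehat P_i\begin{bmatrix}x\\y\end{bmatrix}$. **Finite-horizon problem at $x_0$.** Find $\boldsymbol u$ such that, for all $i$, $u_i$ minimizes over $v_i\in\mathcal U_{i,T}(x_0,\boldsymbol u_{-i})$ the cost $$J_i(v_i|x_0,\boldsymbol u)=\sum_{t=0}^{T-1}\ell_i(\phi[t|x_0,v_i,\boldsymbol u_{-i}],v_i[t])+V_i\big(\phi[T|x_0,v_i,\boldsymbol u_{-i}],\phi[T|x_0,\boldsymbol u]\big).$$ Let $\mathbb X_f$ be a constraint-admissible forward invariant set for $x^+=\bar Ax$: every $x\in\mathbb X_f$ satisfies $x\in\mathbb X$, $K_ix\in\mathbb U_i((K_jx)_{j\ne i})$ for all $i$, and $\bar Ax\in\mathbb X_f$. Let $\mathcal X$ be the set of $x_0\in\mathbb X$ at which the problem has a solution $\boldsymbol u$ with $\phi[T|x_0,\boldsymbol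 u]\in\mathbb X_f$. **Selection.** Let $x\mapsto\boldsymbol u^{FH}(x)$ be a map such that, for $x\in\mathcal X$, $\boldsymbol u^{FH}(x)$ solves the problem at $x$ and $\phi[T|x,\boldsymbol u^{FH}(x)]\in\mathbb X_f$. Assume that shifted solutions are selected: if $x_0\in\mathbb X$, if $\boldsymbol u$ solves the problem at $x_0$, and if the shifted sequence $u^{SH}_i=(u_i[1],\dots,u_i[T-1],K_i\,\phi[T|x_0,\boldsymbol u])$, $i=1,\dots,N$, solves the problem at $x_1=\phi[1|x_0,\boldsymbol u]$, then $\boldsymbol u^{FH}(x_1)=\boldsymbol u^{SH}$. **Theorem.** Under these assumptions the origin is asymptotically stable for the closed-loop system $x^+=Ax+\sum_iB_iu^{FH}_i[0|x]$ with region of attraction $\mathcal X$: the origin is a Lyapunov stable, locally attractive equilibrium, $\mathcal X$ is positively invariant, and every closed-loop trajectory starting in $\mathcal X$ converges to the origin. -/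

import Mathlib

open scoped Matrix Kronecker Topology
open Filter

noncomputable section

namespace OLNE

/-- Real column vectors (their topology is the Euclidean one). -/
abbrev Vec (k : ℕ) : Type := Fin k → ℝ

/-- Collective input sequences `𝐮 = (u_i)_i` of length `T`, with `u i t` the input of agent `i`
at time `t`. -/
abbrev InputSeq (N m T : ℕ) : Type := Fin N → Fin T → Vec m

/-! ### Linear-algebra notions -/

/-- All (complex) eigenvalues lie in the open unit disc. -/
def IsSchur {k : ℕ} (M : Matrix (Fin k) (Fin k) ℝ) : Prop :=
  ∀ z ∈ M.charpoly.aroots ℂ, ‖z‖ < 1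

/-- `(A, B)` is stabilizable. -/
def IsStabilizable {n m : ℕ} (A : Matrix (Fin n) (Fin n) ℝ) (B : Matrix (Fin n) (Fin m) ℝ) :
    Prop :=
  ∃ F : Matrix (Fin m) (Fin n) ℝ, IsSchur (A + B * F)

/-- `(A, C)` is detectable. -/
def IsDetectable {n q : ℕ} (A : Matrix (Fin n) (Fin n) ℝ) (C : Matrix (Fin q) (Fin n) ℝ) :
    Prop :=
  ∃ L : Matrix (Fin n) (Fin q) ℝ, IsSchur (A + L * C)

/-- `W` is invariant under `M`, and the eigenvalues of the restriction of `M` to `W` lie in the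
open unit disc. -/
def IsStableInvariant {ι : Type*} [Fintype ι] (M : Matrix ι ι ℝ) (W : Submodule ℝ (ι → ℝ)) :
    Prop :=
  ∃ h : ∀ w ∈ W, M.mulVecLin w ∈ W,
    ∀ z ∈ (M.mulVecLin.restrict h).charpoly.aroots ℂ, ‖z‖ < 1

/-! ### The game -/

/-- Data of a constrained linear-quadratic dynamic game with `N` agents: the dynamics
`x⁺ = A x + ∑ i, B i u i`, the weights `Q i = (C i)ᵀ C i` and `R i`, the state constraint set `X`
and the coupling input constraint sets `U i (u_{-i})`. -/
structure Game (n m N : ℕ) (p : Fin N → ℕ) where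
  A : Matrix (Fin n) (Fin n) ℝ
  B : Fin N → Matrix (Fin n) (Fin m) ℝ
  C : (i : Fin N) → Matrix (Fin (p i)) (Fin n) ℝ
  R : Fin N → Matrix (Fin m) (Fin m) ℝ
  X : Set (Vec n)
  U : (i : Fin N) → ({j : Fin N // j ≠ i} → Vec m) → Set (Vec m)

namespace Game

variable {n m N : ℕ} {p : Fin N → ℕ} (G : Game n m N p)

/-- State weights. -/
def Q (i : Fin N) : Matrix (Fin n) (Fin n) ℝ := (G.C i)ᵀ * G.C i

/-- `S i = B i (R i)⁻¹ (B i)ᵀ`. -/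
def S (i : Fin N) : Matrix (Fin n) (Fin n) ℝ := G.B i * (G.R i)⁻¹ * (G.B i)ᵀ

/-- A collective input satisfies the input constraints of all agents. -/
def InputAdmissible (w : Fin N → Vec m) : Prop :=
  ∀ i, w i ∈ G.U i (fun j => w j)

/-- The origin is strictly feasible, `R i` is symmetric positive definite (`Q i` is positive
semidefinite by construction). -/
def BasicAssumption : Prop :=
  (0 : Vec n) ∈ interior G.X ∧
  (0 : Fin N → Vec m) ∈ interior {w | G.InputAdmissible w} ∧
  ∀ i, (G.R i).PosDef

/-- `A` is invertible; every `(A, B i)` is stabilizable and every `(A, C i)` is detectable. -/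
def PrimitivesAssumption : Prop :=
  IsUnit G.A ∧ ∀ i, IsStabilizable G.A (G.B i) ∧ IsDetectable G.A (G.C i)

/-- The matrix `H` whose invariant subspaces describe the solutions of the coupled Riccati
equations. -/
def H : Matrix (Fin n ⊕ Fin N × Fin n) (Fin n ⊕ Fin N × Fin n) ℝ :=
  Matrix.fromBlocks
    (G.A + ∑ j, G.S j * (G.A⁻¹)ᵀ * G.Q j)
    (Matrix.of fun a jb => (-(G.S jb.1 * (G.A⁻¹)ᵀ)) a jb.2)
    (Matrix.of fun jb a => (-((G.A⁻¹)ᵀ * G.Q jb.1)) jb.2 a)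
    ((1 : Matrix (Fin N) (Fin N) ℝ) ⊗ₖ (G.A⁻¹)ᵀ)

/-- `H` has exactly `n` eigenvalues (with multiplicity) of modulus smaller than one, and the
`n`-dimensional stable invariant subspace `W` of `H` is complementary to `Im [0; I]`. -/
def StructureAssumption (W : Submodule ℝ (Fin n ⊕ Fin N × Fin n → ℝ)) : Prop :=
  ((G.H.charpoly.aroots ℂ).filter (fun z => ‖z‖ < 1)).card = n ∧
  Module.finrank ℝ W = n ∧
  IsStableInvariant G.H W ∧
  IsCompl W (LinearMap.range
    (Matrix.fromRows (0 : Matrix (Fin n) (Fin N × Fin n) ℝ) 1).mulVecLin)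

/-! ### Unconstrained open-loop Nash equilibrium and terminal cost -/

/-- Closed-loop matrix `A + ∑ i, B i K i`. -/
def Abar (K : Fin N → Matrix (Fin m) (Fin n) ℝ) : Matrix (Fin n) (Fin n) ℝ :=
  G.A + ∑ i, G.B i * K i

/-- The coupled open-loop Riccati equations. -/
def SolvesRiccati (P : Fin N → Matrix (Fin n) (Fin n) ℝ)
    (K : Fin N → Matrix (Fin m) (Fin n) ℝ) : Prop :=
  ∀ i, P i = G.Q i + G.Aᵀ * P i * G.Abar K ∧
    K i = -((G.R i)⁻¹ * (G.B i)ᵀ * P i * G.Abar K)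

/-- The columns of `[I; P 1; …; P N]` lie in `W`. -/
def GraphIn (P : Fin N → Matrix (Fin n) (Fin n) ℝ)
    (W : Submodule ℝ (Fin n ⊕ Fin N × Fin n → ℝ)) : Prop :=
  ∀ x : Vec n, Sum.elim x (fun jb : Fin N × Fin n => (P jb.1 *ᵥ x) jb.2) ∈ W

/-- Augmented dynamics of agent `i`. -/
def Ahat (K : Fin N → Matrix (Fin m) (Fin n) ℝ) (i : Fin N) :
    Matrix (Fin n ⊕ Fin n) (Fin n ⊕ Fin n) ℝ :=
  Matrix.fromBlocks G.A (∑ j ∈ Finset.univ.erase i, G.B j * K j) 0 (G.Abar K)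

/-- Augmented input matrix of agent `i`. -/
def Bhat (i : Fin N) : Matrix (Fin n ⊕ Fin n) (Fin m) ℝ :=
  Matrix.fromRows (G.B i) 0

/-- Augmented state weight of agent `i`. -/
def Qhat (i : Fin N) : Matrix (Fin n ⊕ Fin n) (Fin n ⊕ Fin n) ℝ :=
  Matrix.fromBlocks (G.Q i) 0 0 0

/-- Gain associated with a candidate solution of the augmented Riccati equation. -/
def Khat (K : Fin N → Matrix (Fin m) (Fin n) ℝ) (i : Fin N)
    (Ph : Matrix (Fin n ⊕ Fin n) (Fin n ⊕ Fin n) ℝ) : Matrix (Fin m) (Fin n ⊕ Fin n) ℝ :=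
  -((G.R i + (G.Bhat i)ᵀ * Ph * G.Bhat i)⁻¹ * (G.Bhat i)ᵀ * Ph * G.Ahat K i)

/-- `Ph` is a positive semidefinite solution of the augmented Riccati equation of agent `i`. -/
def SolvesAugmentedRiccati (K : Fin N → Matrix (Fin m) (Fin n) ℝ) (i : Fin N)
    (Ph : Matrix (Fin n ⊕ Fin n) (Fin n ⊕ Fin n) ℝ) : Prop :=
  Ph.PosSemidef ∧
  Ph = G.Qhat i + (G.Ahat K i)ᵀ * Ph * (G.Ahat K i + G.Bhat i * G.Khat K i Ph)

/-- Terminal cost `V(x, y) = ½ ‖(x, y)‖²` in the norm weighted by `Ph`. -/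
def terminalCost (Ph : Matrix (Fin n ⊕ Fin n) (Fin n ⊕ Fin n) ℝ) (x y : Vec n) : ℝ :=
  1 / 2 * (Sum.elim x y ⬝ᵥ Ph *ᵥ Sum.elim x y)

/-- Stage cost of agent `i`. -/
def stageCost (i : Fin N) (x : Vec n) (w : Vec m) : ℝ :=
  1 / 2 * (x ⬝ᵥ G.Q i *ᵥ x) + 1 / 2 * (w ⬝ᵥ G.R i *ᵥ w)

/-! ### The finite-horizon problem -/

/-- State at time `t` from `x₀` under the inputs `u`; only times `t ≤ T` are ever used. -/
def state {T : ℕ} (x₀ : Vec n) (u : InputSeq N m T) : ℕ → Vec n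
  | 0 => x₀
  | t + 1 => G.A *ᵥ state x₀ u t +
      ∑ i, G.B i *ᵥ (if h : t < T then u i ⟨t, h⟩ else 0)

/-- Feasible input sequences of agent `i` given those of the other agents (the component `u i`
plays no role). -/
def feasible {T : ℕ} (x₀ : Vec n) (u : InputSeq N m T) (i : Fin N) : Set (Fin T → Vec m) :=
  {v | (∀ t, v t ∈ G.U i (fun j => u j t)) ∧
    ∀ t, 1 ≤ t → t ≤ T → G.state x₀ (Function.update u i v) t ∈ G.X}

/-- Cost of agent `i` when it plays `v` and `u` is the reference profile. The second argument of
the terminal cost is the terminal state of the reference profile. -/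
def cost {T : ℕ} (Ph : Fin N → Matrix (Fin n ⊕ Fin n) (Fin n ⊕ Fin n) ℝ)
    (x₀ : Vec n) (u : InputSeq N m T) (i : Fin N) (v : Fin T → Vec m) : ℝ :=
  ∑ t : Fin T, G.stageCost i (G.state x₀ (Function.update u i v) t) (v t) +
    terminalCost (Ph i) (G.state x₀ (Function.update u i v) T) (G.state x₀ u T)

/-- `u` solves the finite-horizon problem at `x₀`. -/
def IsSolution {T : ℕ} (Ph : Fin N → Matrix (Fin n ⊕ Fin n) (Fin n ⊕ Fin n) ℝ)
    (x₀ : Vec n) (u : InputSeq N m T) : Prop :=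
  ∀ i, u i ∈ G.feasible x₀ u i ∧
    ∀ v ∈ G.feasible x₀ u i, G.cost Ph x₀ u i (u i) ≤ G.cost Ph x₀ u i v

/-- `Xf` is constraint-admissible and forward invariant for `x⁺ = (A + ∑ i, B i K i) x`. -/
def IsTerminalSet (K : Fin N → Matrix (Fin m) (Fin n) ℝ) (Xf : Set (Vec n)) : Prop :=
  ∀ x ∈ Xf, x ∈ G.X ∧ G.InputAdmissible (fun i => K i *ᵥ x) ∧ G.Abar K *ᵥ x ∈ Xf

/-- Admissible states for which some solution of the finite-horizon problem ends in `Xf`. -/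
def reachableSet (T : ℕ) (Ph : Fin N → Matrix (Fin n ⊕ Fin n) (Fin n ⊕ Fin n) ℝ)
    (Xf : Set (Vec n)) : Set (Vec n) :=
  {x₀ | x₀ ∈ G.X ∧ ∃ u : InputSeq N m T, G.IsSolution Ph x₀ u ∧ G.state x₀ u T ∈ Xf}

/-- Drop the first input of `u` and append the linear feedback at the terminal state. -/
def shift {T : ℕ} (K : Fin N → Matrix (Fin m) (Fin n) ℝ) (x₀ : Vec n) (u : InputSeq N m T) :
    InputSeq N m T :=
  fun i t => if h : (t : ℕ) + 1 < T then u i ⟨t + 1, h⟩ else K i *ᵥ G.state x₀ u T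

/-- The agents select shifted solutions: whenever `u` solves the problem at `x₀ ∈ X` and its
shifted sequence solves the problem at the successor state, the latter is what the selection
`uFH` returns at the successor state. -/
def SelectsShifted {T : ℕ} (Ph : Fin N → Matrix (Fin n ⊕ Fin n) (Fin n ⊕ Fin n) ℝ)
    (K : Fin N → Matrix (Fin m) (Fin n) ℝ) (uFH : Vec n → InputSeq N m T) : Prop :=
  ∀ x₀ ∈ G.X, ∀ u : InputSeq N m T, G.IsSolution Ph x₀ u →
    G.IsSolution Ph (G.state x₀ u 1) (G.shift K x₀ u) →
    uFH (G.state x₀ u 1) = G.shift K x₀ u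

/-- One step of the system under the state feedback `x ↦ uFH[0 | x]`. -/
def closedLoop {T : ℕ} (hT : 0 < T) (uFH : Vec n → InputSeq N m T) (x : Vec n) : Vec n :=
  G.A *ᵥ x + ∑ i, G.B i *ᵥ uFH x i ⟨0, hT⟩

end Game

/-- The origin is an asymptotically stable equilibrium of `x⁺ = f x` (Lyapunov stable and locally
attractive), and `D` is a positively invariant set, all of whose points are attracted to the
origin. -/
def IsAsymptoticallyStableWithRegion {n : ℕ} (f : Vec n → Vec n) (D : Set (Vec n)) : Prop :=
  f 0 = 0 ∧
  (∀ ε > 0, ∃ δ > 0, ∀ x : Vec n, ‖x‖ < δ → ∀ k : ℕ, ‖f^[k] x‖ < ε) ∧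
  (∃ η > 0, ∀ x : Vec n, ‖x‖ < η → Tendsto (fun k : ℕ => f^[k] x) atTop (𝓝 0)) ∧
  (∀ x ∈ D, f x ∈ D) ∧
  ∀ x ∈ D, Tendsto (fun k : ℕ => f^[k] x) atTop (𝓝 0)

end OLNE

end

/-! The terminal cost `V_i(x, y)` is the exact optimal cost-to-go of agent `i` at state `x` when the
other agents play `K_j y` along a reference `y⁺ = Ā y`. It is therefore a lower bound for one more
stage plus the terminal cost, with equality on the diagonal `x = y` under `K_i` (`isTerminalCost`).
The equality requires the augmented gain to restrict to `K_i` on the diagonal (`Khat_mul_diagonal`):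
the relevant block of `P̂_i` and the matrix `P_i` solve the same Stein equation, whose two
coefficients are Schur.

Given this, a deviation from the shifted sequence becomes a deviation from the original one: prepend
the old first input and drop the last one. Optimality at `x₀` thus passes to the successor state
(`IsSolution.shift`), so the selection follows the shifted plan. After `T` steps the closed-loop
state is the predicted terminal state, and from then on it evolves under `Ā`, which is Schur because
it is conjugate to `H` on `W`.

Stability near the origin cannot rest on `Xf`, which need not be a neighbourhood of 0. It uses
instead the largest set on which the feedback `K` stays admissible. That set is a neighbourhood of
0, and there the linear feedback solves the finite-horizon problem. Since `Ā` is invertible, every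
small `x` is the successor `Ā z` of such a state, so shifted selection forces the closed loop to be
linear near 0. -/

noncomputable section

namespace OLNE

/-! ### Powers of Schur matrices and Stein equations. -/

section PowerConvergence

open scoped Matrix.Norms.Operator

/-- Gelfand's formula: for `r` strictly between the spectral radius and 1, eventually `‖a ^ k‖ ≤ r ^
k`. -/
theorem tendsto_pow_zero_of_spectralRadius_lt_one {𝔸 : Type*} [NormedRing 𝔸] [NormedAlgebra ℂ 𝔸]
    [CompleteSpace 𝔸] {a : 𝔸} (ha : spectralRadius ℂ a < 1) :
    Tendsto (fun k : ℕ => a ^ k) atTop (𝓝 0) := by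
  obtain ⟨r, hr, hr1⟩ := ENNReal.lt_iff_exists_nnreal_btwn.1 ha
  have hr1' : r < 1 := by exact_mod_cast hr1
  have h := (spectrum.pow_nnnorm_pow_one_div_tendsto_nhds_spectralRadius a).eventually_lt_const hr
  rw [tendsto_zero_iff_norm_tendsto_zero]
  refine squeeze_zero' (Eventually.of_forall fun _ => norm_nonneg _) ?_
    (tendsto_pow_atTop_nhds_zero_of_lt_one r.2 hr1')
  filter_upwards [h, eventually_gt_atTop 0] with k hk hk0
  have h1 : ((‖a ^ k‖₊ : ENNReal) ^ (1 / k : ℝ)) ^ (k : ℝ) ≤ (r : ENNReal) ^ (k : ℝ) :=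
    ENNReal.rpow_le_rpow hk.le (by positivity)
  rw [← ENNReal.rpow_mul, one_div, inv_mul_cancel₀ (by positivity), ENNReal.rpow_one,
    ENNReal.rpow_natCast] at h1
  have h2 : ‖a ^ k‖₊ ≤ r ^ k := by exact_mod_cast h1
  exact_mod_cast h2

theorem mem_aroots_charpoly {k : ℕ} (M : Matrix (Fin k) (Fin k) ℝ) (z : ℂ) :
    z ∈ M.charpoly.aroots ℂ ↔ (M.map (algebraMap ℝ ℂ)).charpoly.IsRoot z := by
  rw [Polynomial.mem_aroots, Matrix.charpoly_map, Polynomial.IsRoot, Polynomial.eval_map_algebraMap]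
  simp [M.charpoly_monic.ne_zero]

/-- The spectral radius is that of the complexified matrix; taking real parts entrywise recovers the
real powers. -/
theorem IsSchur.tendsto_pow {k : ℕ} {M : Matrix (Fin k) (Fin k) ℝ} (hM : IsSchur M) :
    Tendsto (fun t : ℕ => M ^ t) atTop (𝓝 0) := by
  rcases Nat.eq_zero_or_pos k with rfl | hk
  · exact (tendsto_const_nhds (x := (0 : Matrix (Fin 0) (Fin 0) ℝ))).congr
      fun t => Subsingleton.elim _ _
  have : Nonempty (Fin k) := ⟨⟨0, hk⟩⟩
  have hρ : spectralRadius ℂ (M.map (algebraMap ℝ ℂ)) < (1 : NNReal) := by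
    refine spectrum.spectralRadius_lt_of_forall_lt _ fun z hz => ?_
    exact hM z ((mem_aroots_charpoly M z).2 (Matrix.mem_spectrum_iff_isRoot_charpoly.1 hz))
  have h := tendsto_pow_zero_of_spectralRadius_lt_one (ENNReal.coe_one ▸ hρ)
  have hre : Continuous fun X : Matrix (Fin k) (Fin k) ℂ => X.map Complex.re :=
    continuous_id.matrix_map Complex.continuous_re
  refine ((hre.tendsto 0).comp h).congr' (Eventually.of_forall fun t => ?_) |>.trans (by simp)
  have hpow : M.map (algebraMap ℝ ℂ) ^ t = (M ^ t).map (algebraMap ℝ ℂ) :=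
    (map_pow (algebraMap ℝ ℂ).mapMatrix M t).symm
  rw [Function.comp_apply, hpow]
  ext i j
  simp

/-- The powers of a Schur matrix are uniformly bounded. -/
theorem IsSchur.exists_bound {k : ℕ} {M : Matrix (Fin k) (Fin k) ℝ} (hM : IsSchur M) :
    ∃ c > 0, ∀ (t : ℕ) (x : Vec k), ‖M ^ t *ᵥ x‖ ≤ c * ‖x‖ := by
  obtain ⟨c, hc⟩ := (Metric.isBounded_range_of_tendsto _ hM.tendsto_pow).exists_norm_le
  refine ⟨max c 1, by positivity, fun t x => ?_⟩
  refine (Matrix.linfty_opNorm_mulVec _ _).trans ?_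
  gcongr
  exact (hc _ ⟨t, rfl⟩).trans (le_max_left _ _)

end PowerConvergence

theorem IsSchur.tendsto_pow_mulVec {k : ℕ} {M : Matrix (Fin k) (Fin k) ℝ} (hM : IsSchur M)
    (x : Vec k) : Tendsto (fun t : ℕ => M ^ t *ᵥ x) atTop (𝓝 0) := by
  have h : Continuous fun X : Matrix (Fin k) (Fin k) ℝ => X *ᵥ x := by fun_prop
  simpa [Function.comp_def] using (h.tendsto 0).comp hM.tendsto_pow

/-- A homogeneous Stein equation with Schur coefficients has only the trivial solution. -/
theorem IsSchur.eq_zero_of_stein {k l : ℕ} {M : Matrix (Fin k) (Fin k) ℝ}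
    {N : Matrix (Fin l) (Fin l) ℝ} (hM : IsSchur M) (hN : IsSchur N)
    {X : Matrix (Fin k) (Fin l) ℝ} (hX : X = Mᵀ * X * N) : X = 0 := by
  -- Iterating the equation writes the constant `X` as a sequence that tends to 0.
  have h : ∀ t : ℕ, X = (M ^ t)ᵀ * X * N ^ t := by
    intro t
    induction t with
    | zero => simp
    | succ t ih =>
      conv_lhs => rw [ih, hX]
      simp only [pow_succ' M, pow_succ' N, Matrix.transpose_mul, Matrix.mul_assoc]
  have hc : Continuous fun Y : Matrix (Fin k) (Fin k) ℝ × Matrix (Fin l) (Fin l) ℝ =>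
      Y.1ᵀ * X * Y.2 := by fun_prop
  have h0 := (hc.tendsto (0, 0)).comp (hM.tendsto_pow.prodMk_nhds hN.tendsto_pow)
  simp only [Matrix.mul_zero] at h0
  exact tendsto_nhds_unique (tendsto_const_nhds.congr fun t => h t) h0

/-- A complex root of the characteristic polynomial has an eigenvector with real part `a` and
imaginary part `b`. -/
theorem mem_aroots_charpoly_iff {k : ℕ} (M : Matrix (Fin k) (Fin k) ℝ) (z : ℂ) :
    z ∈ M.charpoly.aroots ℂ ↔ ∃ a b : Vec k, (a ≠ 0 ∨ b ≠ 0) ∧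
      M *ᵥ a = z.re • a - z.im • b ∧ M *ᵥ b = z.im • a + z.re • b := by
  have hre (v : Fin k → ℂ) (i : Fin k) :
      ((M.map (algebraMap ℝ ℂ) *ᵥ v) i).re = (M *ᵥ fun j => (v j).re) i := by
    simp [Matrix.mulVec, dotProduct]
  have him (v : Fin k → ℂ) (i : Fin k) :
      ((M.map (algebraMap ℝ ℂ) *ᵥ v) i).im = (M *ᵥ fun j => (v j).im) i := by
    simp [Matrix.mulVec, dotProduct]
  have key : z ∈ M.charpoly.aroots ℂ ↔
      ∃ v : Fin k → ℂ, v ≠ 0 ∧ M.map (algebraMap ℝ ℂ) *ᵥ v = z • v := by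
    rw [mem_aroots_charpoly, Polynomial.IsRoot, Matrix.eval_charpoly,
      ← Matrix.exists_mulVec_eq_zero_iff]
    refine exists_congr fun v => and_congr_right fun _ => ?_
    rw [Matrix.sub_mulVec, sub_eq_zero, eq_comm, Matrix.scalar_apply, ← Matrix.smul_one_eq_diagonal,
      Matrix.smul_mulVec, Matrix.one_mulVec]
  rw [key]
  constructor
  · rintro ⟨v, hv, h⟩
    refine ⟨fun i => (v i).re, fun i => (v i).im, ?_, ?_, ?_⟩
    · by_contra! hc
      exact hv (funext fun i => Complex.ext (congrFun hc.1 i) (congrFun hc.2 i))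
    · ext i
      rw [← hre, h]; simp
    · ext i
      rw [← him, h]; simp [add_comm]
  · rintro ⟨a, b, h0, ha, hb⟩
    refine ⟨fun i => ⟨a i, b i⟩, fun hv => ?_, ?_⟩
    · rcases h0 with h0 | h0
      · exact h0 (funext fun i => congrArg Complex.re (congrFun hv i))
      · exact h0 (funext fun i => congrArg Complex.im (congrFun hv i))
    · ext i
      apply Complex.ext
      · rw [hre]; simpa using congrFun ha i
      · rw [him]; simpa [add_comm] using congrFun hb i

/-! ### Algebraic identities of the linear-quadratic regulator. -/

section Riccati

variable {ι κ : Type*} [Fintype ι] [Fintype κ]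

/-- Both the feedback gain and the Riccati equation of a linear-quadratic regulator, with the
Hessian `R + Bᵀ P B` assumed invertible. -/
structure IsRiccati (A : Matrix ι ι ℝ) (B : Matrix ι κ ℝ) (Q : Matrix ι ι ℝ) (R : Matrix κ κ ℝ)
    (P : Matrix ι ι ℝ) (K : Matrix κ ι ℝ) : Prop where
  symm_R : Rᵀ = R
  symm_P : Pᵀ = P
  gain : (R + Bᵀ * P * B) * K = -(Bᵀ * P * A)
  eqn : P = Q + Aᵀ * P * (A + B * K)

variable {A : Matrix ι ι ℝ} {B : Matrix ι κ ℝ} {Q : Matrix ι ι ℝ} {R : Matrix κ κ ℝ}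
    {P : Matrix ι ι ℝ} {K : Matrix κ ι ℝ}

/-- A regrouping of the gain equation; in this form it eliminates the cross terms below without any
inverse. -/
theorem IsRiccati.mul_closedLoop (h : IsRiccati A B Q R P K) :
    Bᵀ * P * (A + B * K) = -(R * K) := by
  have := h.gain
  rw [Matrix.add_mul] at this
  rw [Matrix.mul_add, ← Matrix.mul_assoc]
  rw [eq_neg_iff_add_eq_zero] at this ⊢
  rw [← this]
  abel

/-- Replacing the left factor `Aᵀ` of the Riccati equation by `(A + B K)ᵀ` costs `Kᵀ Bᵀ P (A + B
K)`, which is `-Kᵀ R K`. -/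
theorem IsRiccati.lyapunov (h : IsRiccati A B Q R P K) :
    P = Q + Kᵀ * R * K + (A + B * K)ᵀ * P * (A + B * K) := by
  have h1 : Kᵀ * (Bᵀ * P * (A + B * K)) = -(Kᵀ * (R * K)) := by
    rw [h.mul_closedLoop, Matrix.mul_neg]
  conv_lhs => rw [h.eqn]
  rw [Matrix.transpose_add A, Matrix.transpose_mul, Matrix.add_mul Aᵀ, Matrix.add_mul (Aᵀ * P)]
  simp only [Matrix.mul_assoc] at h1 ⊢
  rw [h1]
  abel

theorem mulVec_dotProduct_mulVec {α β γ : Type*} [Fintype α] [Fintype β] [Fintype γ]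
    (X : Matrix α β ℝ) (x : β → ℝ) (Y : Matrix α γ ℝ) (y : γ → ℝ) :
    X *ᵥ x ⬝ᵥ Y *ᵥ y = x ⬝ᵥ (Xᵀ * Y) *ᵥ y := by
  rw [← Matrix.mulVec_mulVec, Matrix.dotProduct_mulVec x, Matrix.vecMul_transpose]

theorem IsRiccati.quadratic (h : IsRiccati A B Q R P K) (ξ : ι → ℝ) :
    ξ ⬝ᵥ P *ᵥ ξ = ξ ⬝ᵥ Q *ᵥ ξ + K *ᵥ ξ ⬝ᵥ R *ᵥ (K *ᵥ ξ) +
      (A + B * K) *ᵥ ξ ⬝ᵥ P *ᵥ ((A + B * K) *ᵥ ξ) := by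
  conv_lhs => rw [h.lyapunov, Matrix.add_mulVec, Matrix.add_mulVec, dotProduct_add, dotProduct_add]
  simp only [Matrix.mulVec_mulVec, mulVec_dotProduct_mulVec, Matrix.mul_assoc]

theorem dotProduct_mulVec_comm_of_symm {α : Type*} [Fintype α] {Y : Matrix α α ℝ} (hY : Yᵀ = Y)
    (x y : α → ℝ) : x ⬝ᵥ Y *ᵥ y = y ⬝ᵥ Y *ᵥ x := by
  rw [Matrix.dotProduct_mulVec, ← Matrix.mulVec_transpose, hY, dotProduct_comm]

/-- Completion of the square. -/
theorem IsRiccati.complete_square (h : IsRiccati A B Q R P K) (ξ : ι → ℝ) (v : κ → ℝ) :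
    (A *ᵥ ξ + B *ᵥ v) ⬝ᵥ P *ᵥ (A *ᵥ ξ + B *ᵥ v) + ξ ⬝ᵥ Q *ᵥ ξ + v ⬝ᵥ R *ᵥ v =
      ξ ⬝ᵥ P *ᵥ ξ + (v - K *ᵥ ξ) ⬝ᵥ (R + Bᵀ * P * B) *ᵥ (v - K *ᵥ ξ) := by
  -- In terms of the deviation `w` from the optimal input, the cross terms of the input cost cancel
  -- those of the cost-to-go.
  obtain ⟨w, rfl⟩ : ∃ w, v = K *ᵥ ξ + w := ⟨v - K *ᵥ ξ, by simp⟩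
  have hs : A *ᵥ ξ + B *ᵥ (K *ᵥ ξ + w) = (A + B * K) *ᵥ ξ + B *ᵥ w := by
    rw [Matrix.mulVec_add, Matrix.add_mulVec, Matrix.mulVec_mulVec, add_assoc]
  have h1 : B *ᵥ w ⬝ᵥ P *ᵥ ((A + B * K) *ᵥ ξ) = -(w ⬝ᵥ R *ᵥ (K *ᵥ ξ)) := by
    rw [Matrix.mulVec_mulVec, mulVec_dotProduct_mulVec, ← Matrix.mul_assoc, h.mul_closedLoop,
      Matrix.neg_mulVec, dotProduct_neg, Matrix.mulVec_mulVec]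
  have h2 : (A + B * K) *ᵥ ξ ⬝ᵥ P *ᵥ (B *ᵥ w) = -(w ⬝ᵥ R *ᵥ (K *ᵥ ξ)) := by
    rw [dotProduct_mulVec_comm_of_symm h.symm_P, h1]
  have h3 : K *ᵥ ξ ⬝ᵥ R *ᵥ w = w ⬝ᵥ R *ᵥ (K *ᵥ ξ) := dotProduct_mulVec_comm_of_symm h.symm_R _ _
  have h5 : w ⬝ᵥ (Bᵀ * P * B) *ᵥ w = B *ᵥ w ⬝ᵥ P *ᵥ (B *ᵥ w) := by
    rw [Matrix.mulVec_mulVec, mulVec_dotProduct_mulVec, Matrix.mul_assoc]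
  rw [hs, add_sub_cancel_left, Matrix.add_mulVec R, dotProduct_add, h5, h.quadratic ξ]
  simp only [Matrix.mulVec_add, dotProduct_add, add_dotProduct]
  rw [h1, h2, h3]
  ring

end Riccati

/-! ### Stability of the optimal regulator. -/

section Regulator

theorem eq_zero_of_posDef_form_eq_zero {m : ℕ} {R : Matrix (Fin m) (Fin m) ℝ} (hR : R.PosDef)
    {w : Vec m} (hw : w ⬝ᵥ R *ᵥ w = 0) : w = 0 := by
  by_contra h
  have := hR.dotProduct_mulVec_pos h
  simp only [star_trivial] at this
  exact this.ne' hw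

/-- The optimal regulator of a detectable system is stabilizing. -/
theorem IsRiccati.isSchur {n m q : ℕ} {A : Matrix (Fin n) (Fin n) ℝ}
    {B : Matrix (Fin n) (Fin m) ℝ} {C : Matrix (Fin q) (Fin n) ℝ} {R : Matrix (Fin m) (Fin m) ℝ}
    {P : Matrix (Fin n) (Fin n) ℝ} {K : Matrix (Fin m) (Fin n) ℝ}
    (h : IsRiccati A B (Cᵀ * C) R P K) (hP : P.PosSemidef) (hR : R.PosDef)
    (hC : IsDetectable A C) : IsSchur (A + B * K) := by
  intro z hz
  by_contra! hz1
  obtain ⟨a, b, h0, ha, hb⟩ := (mem_aroots_charpoly_iff _ z).1 hz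
  have hsq : 1 ≤ z.re ^ 2 + z.im ^ 2 := by
    have h1 := Complex.sq_norm z
    rw [Complex.normSq_apply] at h1
    nlinarith
  have nonneg {k : ℕ} {Y : Matrix (Fin k) (Fin k) ℝ} (hY : Y.PosSemidef) (v : Vec k) :
      0 ≤ v ⬝ᵥ Y *ᵥ v := by simpa using hY.dotProduct_mulVec_nonneg v
  have ea := h.quadratic a
  have eb := h.quadratic b
  have hcomm := dotProduct_mulVec_comm_of_symm h.symm_P a b
  have hQ (v : Vec n) : v ⬝ᵥ (Cᵀ * C) *ᵥ v = C *ᵥ v ⬝ᵥ C *ᵥ v := by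
    rw [mulVec_dotProduct_mulVec]
  rw [ha, hQ] at ea
  rw [hb, hQ] at eb
  simp only [Matrix.mulVec_add, Matrix.mulVec_sub, Matrix.mulVec_smul, dotProduct_add,
    dotProduct_sub, add_dotProduct, sub_dotProduct, dotProduct_smul, smul_dotProduct,
    smul_eq_mul, hcomm] at ea eb
  have hPa := nonneg hP a
  have hPb := nonneg hP b
  have hRa := nonneg hR.posSemidef (K *ᵥ a)
  have hRb := nonneg hR.posSemidef (K *ᵥ b)
  have hCa : 0 ≤ C *ᵥ a ⬝ᵥ C *ᵥ a := by
    simpa using dotProduct_star_self_nonneg (C *ᵥ a)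
  have hCb : 0 ≤ C *ᵥ b ⬝ᵥ C *ᵥ b := by
    simpa using dotProduct_star_self_nonneg (C *ᵥ b)
  -- For the eigenvector `v = a + ib`, the quadratic identities add up to `‖Cv‖² + ‖Kv‖²_R + (|z|² -
  -- 1) v*Pv = 0`. If `|z| ≥ 1`, every term is nonnegative, so `Cv = 0` and `Kv = 0`.
  have hsum : C *ᵥ a ⬝ᵥ C *ᵥ a + C *ᵥ b ⬝ᵥ C *ᵥ b + K *ᵥ a ⬝ᵥ R *ᵥ (K *ᵥ a) +
      K *ᵥ b ⬝ᵥ R *ᵥ (K *ᵥ b) + (z.re ^ 2 + z.im ^ 2 - 1) * (a ⬝ᵥ P *ᵥ a + b ⬝ᵥ P *ᵥ b) = 0 := by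
    linear_combination -ea - eb
  have hprod : 0 ≤ (z.re ^ 2 + z.im ^ 2 - 1) * (a ⬝ᵥ P *ᵥ a + b ⬝ᵥ P *ᵥ b) :=
    mul_nonneg (by linarith) (by linarith)
  have hCa0 : C *ᵥ a = 0 := dotProduct_self_eq_zero.1 (by linarith)
  have hCb0 : C *ᵥ b = 0 := dotProduct_self_eq_zero.1 (by linarith)
  have hKa0 : K *ᵥ a = 0 := eq_zero_of_posDef_form_eq_zero hR (by linarith)
  have hKb0 : K *ᵥ b = 0 := eq_zero_of_posDef_form_eq_zero hR (by linarith)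
  obtain ⟨L, hL⟩ := hC
  -- As `Cv = 0` and `Kv = 0`, the matrices `A + LC` and `A + BK` agree on `v`, so `z` would be an
  -- eigenvalue of the Schur matrix `A + LC`.
  refine absurd (hL z ((mem_aroots_charpoly_iff _ z).2 ⟨a, b, h0, ?_, ?_⟩)) (not_lt.2 hz1)
  · rw [← ha, Matrix.add_mulVec, Matrix.add_mulVec, ← Matrix.mulVec_mulVec,
      ← Matrix.mulVec_mulVec, hCa0, hKa0, Matrix.mulVec_zero, Matrix.mulVec_zero]
  · rw [← hb, Matrix.add_mulVec, Matrix.add_mulVec, ← Matrix.mulVec_mulVec,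
      ← Matrix.mulVec_mulVec, hCb0, hKb0, Matrix.mulVec_zero, Matrix.mulVec_zero]

end Regulator

/-! ### The open-loop Nash gains: spectrum of `Ā` and the augmented gain on the diagonal. -/

namespace Game

variable {n m N : ℕ} {p : Fin N → ℕ} {G : Game n m N p}
  {P : Fin N → Matrix (Fin n) (Fin n) ℝ} {K : Fin N → Matrix (Fin m) (Fin n) ℝ}

theorem SolvesRiccati.S_mul (h : G.SolvesRiccati P K) (i : Fin N) :
    G.S i * P i * G.Abar K = -(G.B i * K i) := by
  rw [(h i).2, S]
  simp only [Matrix.mul_assoc, Matrix.mul_neg, neg_neg]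

/-- The gain equations give `(I + ∑ S_i P_i) Ā = A`, so `det Ā` divides a unit. -/
theorem SolvesRiccati.isUnit_Abar (h : G.SolvesRiccati P K) (hA : IsUnit G.A) :
    IsUnit (G.Abar K) := by
  have e : (1 + ∑ i, G.S i * P i) * G.Abar K = G.A := by
    rw [Matrix.add_mul, Matrix.sum_mul, Finset.sum_congr rfl fun i _ => h.S_mul i, Matrix.one_mul,
      Finset.sum_neg_distrib, Abar, add_neg_cancel_right]
  rw [Matrix.isUnit_iff_isUnit_det] at hA ⊢
  rw [← e, Matrix.det_mul] at hA
  exact isUnit_of_mul_isUnit_right hA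

/-- On the graph of `P`, the state component of `H` is the closed-loop dynamics. -/
theorem SolvesRiccati.H_mulVec_inl (h : G.SolvesRiccati P K) (hA : IsUnit G.A) (x : Vec n)
    (a : Fin n) :
    (G.H *ᵥ Sum.elim x fun jb : Fin N × Fin n => (P jb.1 *ᵥ x) jb.2) (Sum.inl a) =
      (G.Abar K *ᵥ x) a := by
  have hAT : (G.A⁻¹)ᵀ * G.Aᵀ = 1 := by
    rw [← Matrix.transpose_mul, Matrix.mul_nonsing_inv _ ((Matrix.isUnit_iff_isUnit_det _).1 hA),
      Matrix.transpose_one]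
  have hj (j : Fin N) : G.S j * (G.A⁻¹)ᵀ * G.Q j - G.S j * (G.A⁻¹)ᵀ * P j = G.B j * K j := by
    rw [← Matrix.mul_sub]
    have : G.Q j - P j = -(G.Aᵀ * P j * G.Abar K) := by
      rw [← neg_sub, neg_inj, sub_eq_iff_eq_add', ← (h j).1]
    rw [this, Matrix.mul_neg, Matrix.mul_assoc (G.S j), Matrix.mul_assoc G.Aᵀ,
      ← Matrix.mul_assoc _ G.Aᵀ, hAT, Matrix.one_mul, ← Matrix.mul_assoc, h.S_mul, neg_neg]
  have h2 : ((Matrix.of fun (a : Fin n) (jb : Fin N × Fin n) =>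
      (-(G.S jb.1 * (G.A⁻¹)ᵀ)) a jb.2) *ᵥ fun jb : Fin N × Fin n => (P jb.1 *ᵥ x) jb.2) =
      -∑ j, (G.S j * (G.A⁻¹)ᵀ * P j) *ᵥ x := by
    ext a
    have hmul (j : Fin N) : (G.S j * (G.A⁻¹)ᵀ * P j) *ᵥ x = (G.S j * (G.A⁻¹)ᵀ) *ᵥ (P j *ᵥ x) :=
      (Matrix.mulVec_mulVec _ _ _).symm
    simp only [hmul]
    simp [-Matrix.mulVec_mulVec, Matrix.mulVec, dotProduct, Fintype.sum_prod_type]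
  have h3 : (G.A + ∑ j, G.S j * (G.A⁻¹)ᵀ * G.Q j) *ᵥ x - ∑ j, (G.S j * (G.A⁻¹)ᵀ * P j) *ᵥ x =
      G.Abar K *ᵥ x := by
    rw [← Matrix.sum_mulVec, ← Matrix.sub_mulVec, add_sub_assoc, ← Finset.sum_sub_distrib,
      Finset.sum_congr rfl fun j _ => hj j, Abar]
  rw [H, Matrix.fromBlocks_mulVec, Sum.elim_inl, Sum.elim_comp_inl, Sum.elim_comp_inr, h2,
    ← sub_eq_add_neg, h3]

/-- The map `x ↦ (x, P_1 x, …, P_N x)` is injective into `W`, hence an isomorphism by dimension, and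
it conjugates `Ā` to the restriction of `H`. -/
theorem SolvesRiccati.isSchur_Abar (h : G.SolvesRiccati P K) (hA : IsUnit G.A)
    {W : Submodule ℝ (Fin n ⊕ Fin N × Fin n → ℝ)} (hW : G.StructureAssumption W)
    (hPW : GraphIn P W) : IsSchur (G.Abar K) := by
  obtain ⟨-, hdim, ⟨hinv, hroots⟩, -⟩ := hW
  let g : Vec n →ₗ[ℝ] W :=
    { toFun := fun x => ⟨Sum.elim x fun jb => (P jb.1 *ᵥ x) jb.2, hPW x⟩
      map_add' := fun x y => by
        ext (a | jb) <;> simp [Matrix.mulVec_add]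
      map_smul' := fun c x => by
        ext (a | jb) <;> simp [Matrix.mulVec_smul] }
  have hg : Function.Injective g := fun x y hxy => by
    ext a
    exact congrFun (congrArg Subtype.val hxy) (Sum.inl a)
  let e : Vec n ≃ₗ[ℝ] W := LinearEquiv.ofInjectiveOfFinrankEq g hg (by simp [hdim])
  have hval (x : Vec n) (a : Fin n) : (e x : Fin n ⊕ Fin N × Fin n → ℝ) (Sum.inl a) = x a := rfl
  have hconj : G.H.mulVecLin.restrict hinv = e.conj (G.Abar K).mulVecLin := by
    ext1 w
    obtain ⟨x, rfl⟩ := e.surjective w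
    rw [LinearEquiv.conj_apply_apply, e.symm_apply_apply]
    -- Since `H` preserves `W`, the image is some `e y`, and `y` is read off its state block; the
    -- costate rows of `H` need not be computed.
    obtain ⟨y, hy⟩ := e.surjective (G.H.mulVecLin.restrict hinv (e x))
    rw [← hy]
    congr 1
    ext a
    rw [← hval y, hy]
    exact h.H_mulVec_inl hA x a
  rwa [hconj, LinearEquiv.charpoly_conj, Matrix.charpoly_mulVecLin] at hroots

theorem isRiccati_augmented {i : Fin N} {Ph : Matrix (Fin n ⊕ Fin n) (Fin n ⊕ Fin n) ℝ}
    (hR : (G.R i).PosDef) (hPh : G.SolvesAugmentedRiccati K i Ph) :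
    (G.R i + (G.Bhat i)ᵀ * Ph * G.Bhat i).PosDef ∧
      IsRiccati (G.Ahat K i) (G.Bhat i) (G.Qhat i) (G.R i) Ph (G.Khat K i Ph) := by
  have hM : (G.R i + (G.Bhat i)ᵀ * Ph * G.Bhat i).PosDef := by
    refine hR.add_posSemidef ?_
    have := hPh.1.conjTranspose_mul_mul_same (G.Bhat i)
    rwa [Matrix.conjTranspose_eq_transpose_of_trivial] at this
  refine ⟨hM, ⟨?_, ?_, ?_, hPh.2⟩⟩
  · simpa [Matrix.conjTranspose_eq_transpose_of_trivial] using hR.1.eq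
  · simpa [Matrix.conjTranspose_eq_transpose_of_trivial] using hPh.1.1.eq
  · have hu := (Matrix.isUnit_iff_isUnit_det _).1 hM.isUnit
    have hmul : G.Khat K i Ph = -((G.R i + (G.Bhat i)ᵀ * Ph * G.Bhat i)⁻¹ *
        ((G.Bhat i)ᵀ * Ph * G.Ahat K i)) := by
      simp only [Khat, Matrix.mul_assoc]
    rw [hmul, Matrix.mul_neg, Matrix.mul_nonsing_inv_cancel_left _ _ hu]

/-- On the diagonal, the augmented gain coincides with the open-loop Nash gain. -/
theorem Khat_mul_diagonal {i : Fin N} {Ph : Matrix (Fin n ⊕ Fin n) (Fin n ⊕ Fin n) ℝ}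
    (hR : (G.R i).PosDef) (hC : IsDetectable G.A (G.C i)) (hPK : G.SolvesRiccati P K)
    (hAbar : IsSchur (G.Abar K)) (hPh : G.SolvesAugmentedRiccati K i Ph) :
    G.Khat K i Ph * (Matrix.fromRows 1 1 : Matrix (Fin n ⊕ Fin n) (Fin n) ℝ) = K i := by
  obtain ⟨hM, hric⟩ := isRiccati_augmented hR hPh
  set Kh := G.Khat K i Ph
  -- `E` embeds the diagonal `(x, x)` and `F` the first component `(x, 0)`.
  set E : Matrix (Fin n ⊕ Fin n) (Fin n) ℝ := Matrix.fromRows 1 1 with hE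
  set F : Matrix (Fin n ⊕ Fin n) (Fin n) ℝ := Matrix.fromRows 1 0 with hF
  have hAF : G.Ahat K i * F = F * G.A := by
    simp [hF, Ahat, Matrix.fromBlocks_mul_fromRows, Matrix.fromRows_mul]
  have hBF : G.Bhat i = F * G.B i := by
    simp [hF, Bhat, Matrix.fromRows_mul]
  -- `Âᵢ` omits the input of agent `i`, hence the correction `F Bᵢ Kᵢ`.
  have hAE : G.Ahat K i * E = E * G.Abar K - F * (G.B i * K i) := by
    have : G.A + ∑ j ∈ Finset.univ.erase i, G.B j * K j = G.Abar K - G.B i * K i := by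
      rw [Abar, ← Finset.add_sum_erase _ _ (Finset.mem_univ i)]
      abel
    ext (a | a) b
    · simpa [hE, hF, Ahat, Matrix.fromBlocks_mul_fromRows, Matrix.fromRows_mul] using
        congrFun (congrFun this a) b
    · simp [hE, hF, Ahat, Matrix.fromBlocks_mul_fromRows, Matrix.fromRows_mul]
  have hQF : Fᵀ * G.Qhat i * F = G.Q i := by
    simp [hF, Qhat, Matrix.transpose_fromRows, Matrix.mul_assoc, Matrix.fromBlocks_mul_fromRows,
      Matrix.fromCols_mul_fromRows]
  have hQE : Fᵀ * G.Qhat i * E = G.Q i := by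
    simp [hE, hF, Qhat, Matrix.transpose_fromRows, Matrix.mul_assoc,
      Matrix.fromBlocks_mul_fromRows, Matrix.fromCols_mul_fromRows]
  have hclF : (G.Ahat K i + G.Bhat i * Kh) * F = F * (G.A + G.B i * (Kh * F)) := by
    rw [Matrix.add_mul, hAF, hBF, Matrix.mul_add, Matrix.mul_assoc, Matrix.mul_assoc]
  -- The leading block of the augmented equation is the standard regulator of agent `i` alone, so
  -- detectability makes its closed loop Schur.
  have h11 : IsRiccati G.A (G.B i) (G.Q i) (G.R i) (Fᵀ * Ph * F) (Kh * F) := by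
    refine ⟨hric.symm_R, ?_, ?_, ?_⟩
    · rw [Matrix.transpose_mul, Matrix.transpose_mul, hric.symm_P, Matrix.transpose_transpose,
        Matrix.mul_assoc]
    · have := congrArg (· * F) hric.gain
      simp only [Matrix.neg_mul, Matrix.mul_assoc, hAF] at this
      simp only [hBF, Matrix.transpose_mul, Matrix.mul_assoc] at this
      simpa only [Matrix.mul_assoc] using this
    · conv_lhs => rw [hric.eqn]
      rw [Matrix.mul_add, Matrix.add_mul, hQF]
      simp only [Matrix.mul_assoc]
      rw [hclF, ← Matrix.mul_assoc Fᵀ, ← Matrix.transpose_mul, hAF, Matrix.transpose_mul]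
      simp only [Matrix.mul_assoc]
  have hP11 : (Fᵀ * Ph * F).PosSemidef := by
    have := hPh.1.conjTranspose_mul_mul_same F
    rwa [Matrix.conjTranspose_eq_transpose_of_trivial] at this
  have hSchur : IsSchur (G.A + G.B i * (Kh * F)) := IsRiccati.isSchur h11 hP11 hR hC
  have hRK : G.R i * K i = -((G.B i)ᵀ * P i * G.Abar K) := by
    conv_lhs => rw [(hPK i).2]
    rw [Matrix.mul_neg, Matrix.mul_assoc, Matrix.mul_assoc, Matrix.mul_nonsing_inv_cancel_left _ _
      ((Matrix.isUnit_iff_isUnit_det _).1 hR.isUnit), Matrix.mul_assoc]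
  -- Both sides satisfy `Z = Q_i + Mᵀ Z Ā + (Kh F)ᵀ R_i K_i`; their difference solves a homogeneous
  -- Stein equation.
  have hZ : Fᵀ * Ph * E = P i := by
    set M := G.A + G.B i * (Kh * F) with hMdef
    have hMB : Mᵀ * (Fᵀ * Ph * F) * G.B i = -((Kh * F)ᵀ * G.R i) := by
      have := congrArg Matrix.transpose h11.mul_closedLoop
      rwa [Matrix.transpose_mul, Matrix.transpose_mul, Matrix.transpose_transpose, h11.symm_P,
        Matrix.transpose_neg, Matrix.transpose_mul, h11.symm_R, ← Matrix.mul_assoc] at this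
    have hZ1 : Fᵀ * Ph * E = G.Q i + Mᵀ * (Fᵀ * Ph * E) * G.Abar K +
        (Kh * F)ᵀ * G.R i * K i := by
      have ht : Ph = G.Qhat i + (G.Ahat K i + G.Bhat i * Kh)ᵀ * Ph * G.Ahat K i := by
        have hq : (G.Qhat i)ᵀ = G.Qhat i := by
          simp [Qhat, Q, Matrix.fromBlocks_transpose]
        have := congrArg Matrix.transpose hric.eqn
        rwa [hric.symm_P, Matrix.transpose_add, hq, Matrix.transpose_mul, Matrix.transpose_mul,
          Matrix.transpose_transpose, hric.symm_P, ← Matrix.mul_assoc] at this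
      conv_lhs => rw [ht]
      rw [Matrix.mul_add, Matrix.add_mul, hQE, add_assoc]
      congr 1
      have e1 : Fᵀ * ((G.Ahat K i + G.Bhat i * Kh)ᵀ * Ph * G.Ahat K i) * E =
          ((G.Ahat K i + G.Bhat i * Kh) * F)ᵀ * Ph * (G.Ahat K i * E) := by
        rw [Matrix.transpose_mul]
        simp only [Matrix.mul_assoc]
      have e2 : (Kh * F)ᵀ * G.R i * K i = -(Mᵀ * (Fᵀ * Ph * F) * G.B i * K i) := by
        rw [hMB, Matrix.neg_mul, neg_neg]
      rw [e1, hclF, hAE, e2, Matrix.mul_sub, Matrix.transpose_mul, sub_eq_add_neg]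
      simp only [Matrix.mul_assoc]
    have hZ2 : P i = G.Q i + Mᵀ * P i * G.Abar K + (Kh * F)ᵀ * G.R i * K i := by
      conv_lhs => rw [(hPK i).1]
      rw [Matrix.mul_assoc _ (G.R i), hRK, hMdef, Matrix.transpose_add, Matrix.transpose_mul]
      simp only [Matrix.add_mul, Matrix.mul_neg, Matrix.mul_assoc]
      abel
    have hdiff : Fᵀ * Ph * E - P i = Mᵀ * (Fᵀ * Ph * E - P i) * G.Abar K := by
      conv_lhs => rw [hZ1, hZ2]
      rw [Matrix.mul_sub, Matrix.sub_mul]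
      abel
    exact sub_eq_zero.1 (hSchur.eq_zero_of_stein hAbar hdiff)
  have hgain : (G.R i + (G.Bhat i)ᵀ * Ph * G.Bhat i) * (Kh * E) =
      (G.R i + (G.Bhat i)ᵀ * Ph * G.Bhat i) * K i := by
    have e1 : (G.Bhat i)ᵀ * Ph * (E * G.Abar K) = -(G.R i * K i) := by
      rw [hRK, neg_neg, hBF, ← hZ, Matrix.transpose_mul]
      simp only [Matrix.mul_assoc]
    rw [← Matrix.mul_assoc, hric.gain, Matrix.neg_mul, Matrix.mul_assoc, hAE, Matrix.mul_sub, e1,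
      Matrix.add_mul, ← Matrix.mul_assoc F, ← hBF, ← Matrix.mul_assoc]
    abel
  have hu := (Matrix.isUnit_iff_isUnit_det _).1 hM.isUnit
  have := congrArg (fun X => (G.R i + (G.Bhat i)ᵀ * Ph * G.Bhat i)⁻¹ * X) hgain
  simpa only [Matrix.nonsing_inv_mul_cancel_left _ _ hu] using this

end Game

/-! ### The terminal cost as a cost-to-go, and shifted input sequences. -/

namespace Game

variable {n m N : ℕ} {p : Fin N → ℕ} {G : Game n m N p}
  {K : Fin N → Matrix (Fin m) (Fin n) ℝ}
  {Ph : Fin N → Matrix (Fin n ⊕ Fin n) (Fin n ⊕ Fin n) ℝ}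

theorem Abar_mulVec (x : Vec n) :
    G.Abar K *ᵥ x = G.A *ᵥ x + ∑ i, G.B i *ᵥ (K i *ᵥ x) := by
  simp only [Abar, Matrix.add_mulVec, Matrix.sum_mulVec, Matrix.mulVec_mulVec]

/-- The terminal cost of each agent is its optimal cost-to-go when the other agents apply the
feedback `K` along the closed-loop trajectory, and `K` attains it on the diagonal. -/
structure IsTerminalCost (G : Game n m N p) (K : Fin N → Matrix (Fin m) (Fin n) ℝ)
    (Ph : Fin N → Matrix (Fin n ⊕ Fin n) (Fin n ⊕ Fin n) ℝ) : Prop where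
  le : ∀ (i : Fin N) (x y : Vec n) (w : Fin N → Vec m), (∀ j ≠ i, w j = K j *ᵥ y) →
    terminalCost (Ph i) x y ≤ G.stageCost i x (w i) +
      terminalCost (Ph i) (G.A *ᵥ x + ∑ j, G.B j *ᵥ w j) (G.Abar K *ᵥ y)
  eq : ∀ (i : Fin N) (y : Vec n), G.stageCost i y (K i *ᵥ y) +
    terminalCost (Ph i) (G.Abar K *ᵥ y) (G.Abar K *ᵥ y) = terminalCost (Ph i) y y

/-- Completion of the square in the augmented state `(x, y)`: the other inputs are functions of `y`,
so agent `i` faces a single-agent regulator. -/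
theorem stageCost_add_terminalCost {i : Fin N} {Phi : Matrix (Fin n ⊕ Fin n) (Fin n ⊕ Fin n) ℝ}
    {Kh : Matrix (Fin m) (Fin n ⊕ Fin n) ℝ}
    (h : IsRiccati (G.Ahat K i) (G.Bhat i) (G.Qhat i) (G.R i) Phi Kh) (x y : Vec n)
    (w : Fin N → Vec m) (hw : ∀ j ≠ i, w j = K j *ᵥ y) :
    G.stageCost i x (w i) +
        terminalCost Phi (G.A *ᵥ x + ∑ j, G.B j *ᵥ w j) (G.Abar K *ᵥ y) =
      terminalCost Phi x y + 1 / 2 * ((w i - Kh *ᵥ Sum.elim x y) ⬝ᵥ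
        (G.R i + (G.Bhat i)ᵀ * Phi * G.Bhat i) *ᵥ (w i - Kh *ᵥ Sum.elim x y)) := by
  have hdyn : Sum.elim (G.A *ᵥ x + ∑ j, G.B j *ᵥ w j) (G.Abar K *ᵥ y) =
      G.Ahat K i *ᵥ Sum.elim x y + G.Bhat i *ᵥ w i := by
    have hsum : ∑ j, G.B j *ᵥ w j =
        (∑ j ∈ Finset.univ.erase i, G.B j * K j) *ᵥ y + G.B i *ᵥ w i := by
      rw [← Finset.sum_erase_add _ _ (Finset.mem_univ i), Matrix.sum_mulVec]
      congr 1
      refine Finset.sum_congr rfl fun j hj => ?_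
      rw [hw j (Finset.ne_of_mem_erase hj), Matrix.mulVec_mulVec]
    rw [hsum]
    ext (a | a)
    · simp [Ahat, Bhat, Matrix.fromBlocks_mulVec, Matrix.fromRows_mulVec, add_assoc]
    · simp [Ahat, Bhat, Matrix.fromBlocks_mulVec, Matrix.fromRows_mulVec]
  have hQ : Sum.elim x y ⬝ᵥ G.Qhat i *ᵥ Sum.elim x y = x ⬝ᵥ G.Q i *ᵥ x := by
    simp [Qhat, Matrix.fromBlocks_mulVec]
  have hsq := h.complete_square (Sum.elim x y) (w i)
  rw [hQ] at hsq
  rw [terminalCost, terminalCost, stageCost, hdyn]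
  linear_combination (1 / 2 : ℝ) * hsq

/-- The square is nonnegative, and it vanishes at `x = y`, `w_i = K_i y` because the augmented gain
is `K_i` on the diagonal. -/
theorem isTerminalCost {P : Fin N → Matrix (Fin n) (Fin n) ℝ} (hR : ∀ i, (G.R i).PosDef)
    (hC : ∀ i, IsDetectable G.A (G.C i)) (hPK : G.SolvesRiccati P K)
    (hAbar : IsSchur (G.Abar K)) (hPh : ∀ i, G.SolvesAugmentedRiccati K i (Ph i)) :
    G.IsTerminalCost K Ph where
  le i x y w hw := by
    obtain ⟨hM, hric⟩ := isRiccati_augmented (hR i) (hPh i)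
    rw [stageCost_add_terminalCost hric x y w hw]
    have := hM.posSemidef.dotProduct_mulVec_nonneg (w i - G.Khat K i (Ph i) *ᵥ Sum.elim x y)
    simp only [star_trivial] at this
    linarith
  eq i y := by
    obtain ⟨hM, hric⟩ := isRiccati_augmented (hR i) (hPh i)
    have hd : Sum.elim y y = (Matrix.fromRows 1 1 : Matrix (Fin n ⊕ Fin n) (Fin n) ℝ) *ᵥ y := by
      rw [Matrix.fromRows_mulVec, Matrix.one_mulVec]
    have h := stageCost_add_terminalCost hric y y (fun j => K j *ᵥ y) fun _ _ => rfl
    rw [← Abar_mulVec, hd, Matrix.mulVec_mulVec,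
      Khat_mul_diagonal (hR i) (hC i) hPK hAbar (hPh i), sub_self, zero_dotProduct, mul_zero,
      add_zero] at h
    exact h

section Trajectories

variable {T : ℕ}

theorem state_fin_succ (x₀ : Vec n) (u : InputSeq N m T) (t : Fin T) :
    G.state x₀ u (t + 1) = G.A *ᵥ G.state x₀ u t + ∑ i, G.B i *ᵥ u i t := by
  simp [state]

variable {S : ℕ}

theorem shift_castSucc (x₀ : Vec n) (u : InputSeq N m (S + 1)) (i : Fin N) (s : Fin S) :
    G.shift K x₀ u i s.castSucc = u i s.succ := by
  simp [shift, Fin.succ]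

theorem shift_last (x₀ : Vec n) (u : InputSeq N m (S + 1)) (i : Fin N) :
    G.shift K x₀ u i (Fin.last S) = K i *ᵥ G.state x₀ u (S + 1) := by
  simp [shift]

/-- Deviating to `v` after the shift is deviating to `(u_i[0], v[0], …)` one step earlier. The last
entry of `v` does not affect states up to time `S`, whence the restriction on `t`. -/
theorem state_shift_update (x₀ : Vec n) (u : InputSeq N m (S + 1)) (i : Fin N)
    (v : Fin (S + 1) → Vec m) {t : ℕ} (ht : t ≤ S) :
    G.state (G.state x₀ u 1) (Function.update (G.shift K x₀ u) i v) t =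
      G.state x₀ (Function.update u i (Fin.cons (u i 0) fun s : Fin S => v s.castSucc))
        (t + 1) := by
  induction t with
  | zero =>
    refine (state_fin_succ x₀ u 0).trans (Eq.trans ?_ (state_fin_succ x₀ _ 0).symm)
    change G.A *ᵥ x₀ + _ = G.A *ᵥ x₀ + _
    congr 1
    refine Finset.sum_congr rfl fun j _ => ?_
    rcases eq_or_ne j i with rfl | hj
    · simp
    · simp [hj]
  | succ t ih =>
    have h1 := state_fin_succ (G := G) (G.state x₀ u 1) (Function.update (G.shift K x₀ u) i v)
      (Fin.castSucc ⟨t, ht⟩)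
    have h2 := state_fin_succ (G := G) x₀
      (Function.update u i (Fin.cons (u i 0) fun s : Fin S => v s.castSucc)) (Fin.succ ⟨t, ht⟩)
    simp only [Fin.val_castSucc, Fin.val_succ] at h1 h2
    rw [h1, h2, ih (by omega)]
    congr 1
    refine Finset.sum_congr rfl fun j _ => ?_
    rcases eq_or_ne j i with rfl | hj
    · simp only [Function.update_self, Fin.cons_succ]
    · simp only [Function.update_of_ne hj, shift_castSucc]

theorem cons_shift (x₀ : Vec n) (u : InputSeq N m (S + 1)) (i : Fin N) :
    (Fin.cons (u i 0) fun s : Fin S => G.shift K x₀ u i s.castSucc : Fin (S + 1) → Vec m) =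
      u i := by
  ext1 t
  refine Fin.cases ?_ (fun s => ?_) t
  · simp
  · rw [Fin.cons_succ, shift_castSucc]

theorem state_shift (hN : 0 < N) (x₀ : Vec n) (u : InputSeq N m (S + 1)) {t : ℕ} (ht : t ≤ S) :
    G.state (G.state x₀ u 1) (G.shift K x₀ u) t = G.state x₀ u (t + 1) := by
  have h := state_shift_update (G := G) (K := K) x₀ u ⟨0, hN⟩ (G.shift K x₀ u ⟨0, hN⟩) ht
  rwa [cons_shift, Function.update_eq_self, Function.update_eq_self] at h

theorem state_shift_last (hN : 0 < N) (x₀ : Vec n) (u : InputSeq N m (S + 1)) :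
    G.state (G.state x₀ u 1) (G.shift K x₀ u) (S + 1) = G.Abar K *ᵥ G.state x₀ u (S + 1) := by
  have h := state_fin_succ (G := G) (G.state x₀ u 1) (G.shift K x₀ u) (Fin.last S)
  simp only [Fin.val_last] at h
  rw [h, state_shift hN x₀ u le_rfl, Abar_mulVec]
  simp only [shift_last]

theorem cost_cons (x₀ : Vec n) (u : InputSeq N m (S + 1)) (i : Fin N) (v : Fin (S + 1) → Vec m) :
    G.cost Ph x₀ u i (Fin.cons (u i 0) fun s : Fin S => v s.castSucc) =
      G.stageCost i x₀ (u i 0) +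
        ∑ s : Fin S, G.stageCost i (G.state (G.state x₀ u 1)
          (Function.update (G.shift K x₀ u) i v) s) (v s.castSucc) +
        terminalCost (Ph i) (G.state (G.state x₀ u 1)
          (Function.update (G.shift K x₀ u) i v) S) (G.state x₀ u (S + 1)) := by
  rw [cost, Fin.sum_univ_succ, state_shift_update x₀ u i v le_rfl]
  congr 2
  refine Finset.sum_congr rfl fun s _ => ?_
  rw [state_shift_update x₀ u i v s.2.le, Fin.cons_succ, Fin.val_succ]

theorem cost_shift (hN : 0 < N) (x₀ : Vec n) (u : InputSeq N m (S + 1)) (i : Fin N)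
    (v : Fin (S + 1) → Vec m) :
    G.cost Ph (G.state x₀ u 1) (G.shift K x₀ u) i v =
      ∑ s : Fin S, G.stageCost i (G.state (G.state x₀ u 1)
          (Function.update (G.shift K x₀ u) i v) s) (v s.castSucc) +
        (G.stageCost i (G.state (G.state x₀ u 1) (Function.update (G.shift K x₀ u) i v) S)
          (v (Fin.last S)) +
        terminalCost (Ph i) (G.state (G.state x₀ u 1)
          (Function.update (G.shift K x₀ u) i v) (S + 1))
          (G.Abar K *ᵥ G.state x₀ u (S + 1))) := by
  rw [cost, Fin.sum_univ_castSucc, state_shift_last hN, add_assoc]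
  simp only [Fin.val_castSucc, Fin.val_last]

/-- The costs differ only in the tail. At the last stage the others play `K_j y`, with `y` the
reference terminal state, which is the situation of `IsTerminalCost.le`. -/
theorem cost_cons_le_cost_shift (hV : G.IsTerminalCost K Ph) (hN : 0 < N) (x₀ : Vec n)
    (u : InputSeq N m (S + 1)) (i : Fin N) (v : Fin (S + 1) → Vec m) :
    G.cost Ph x₀ u i (Fin.cons (u i 0) fun s : Fin S => v s.castSucc) ≤
      G.stageCost i x₀ (u i 0) + G.cost Ph (G.state x₀ u 1) (G.shift K x₀ u) i v := by
  rw [cost_cons (K := K), cost_shift hN]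
  have hs := state_fin_succ (G := G) (G.state x₀ u 1) (Function.update (G.shift K x₀ u) i v)
    (Fin.last S)
  simp only [Fin.val_last] at hs
  have h := hV.le i (G.state (G.state x₀ u 1) (Function.update (G.shift K x₀ u) i v) S)
    (G.state x₀ u (S + 1)) (fun j => Function.update (G.shift K x₀ u) i v j (Fin.last S))
    (fun j hj => by rw [Function.update_of_ne hj, shift_last])
  rw [← hs, Function.update_self] at h
  linarith

/-- Without deviation the tail lies on the diagonal, where `IsTerminalCost.eq` applies. -/
theorem cost_eq_cost_shift (hV : G.IsTerminalCost K Ph) (hN : 0 < N) (x₀ : Vec n)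
    (u : InputSeq N m (S + 1)) (i : Fin N) :
    G.cost Ph x₀ u i (u i) = G.stageCost i x₀ (u i 0) +
      G.cost Ph (G.state x₀ u 1) (G.shift K x₀ u) i (G.shift K x₀ u i) := by
  have h := cost_cons (G := G) (K := K) (Ph := Ph) x₀ u i (G.shift K x₀ u i)
  rw [cons_shift] at h
  rw [h, cost_shift hN, Function.update_eq_self, state_shift hN x₀ u le_rfl,
    state_shift_last hN, shift_last, hV.eq, add_assoc]

/-- The shifted sequence of a solution that ends in a terminal set is again a solution. -/
theorem IsSolution.shift (hV : G.IsTerminalCost K Ph) (hN : 0 < N) {Xf : Set (Vec n)}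
    (hXf : G.IsTerminalSet K Xf) {x₀ : Vec n} {u : InputSeq N m (S + 1)}
    (hu : G.IsSolution Ph x₀ u) (hy : G.state x₀ u (S + 1) ∈ Xf) :
    G.IsSolution Ph (G.state x₀ u 1) (G.shift K x₀ u) := by
  obtain ⟨-, hadm, hnext⟩ := hXf _ hy
  have hX (t : ℕ) (h1 : 1 ≤ t) (hT : t ≤ S + 1) : G.state x₀ u t ∈ G.X := by
    simpa using (hu ⟨0, hN⟩).1.2 t h1 hT
  intro i
  refine ⟨⟨fun t => ?_, fun t _ hT => ?_⟩, fun v hv => ?_⟩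
  · refine Fin.lastCases ?_ (fun s => ?_) t
    · simp only [shift_last]
      exact hadm i
    · simp only [shift_castSucc]
      exact (hu i).1.1 s.succ
  · rw [Function.update_eq_self]
    rcases Nat.lt_or_ge S t with h | h
    · obtain rfl : t = S + 1 := by omega
      rw [state_shift_last hN]
      exact (hXf _ hnext).1
    · rw [state_shift hN x₀ u h]
      exact hX _ (by omega) (by omega)
  · have hfeas : (Fin.cons (u i 0) fun s : Fin S => v s.castSucc : Fin (S + 1) → Vec m) ∈
        G.feasible x₀ u i := by
      refine ⟨fun t => ?_, fun t h1 hT => ?_⟩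
      · refine Fin.cases ?_ (fun s => ?_) t
        · exact (hu i).1.1 0
        · have := hv.1 s.castSucc
          simp only [shift_castSucc] at this
          rwa [Fin.cons_succ]
      · obtain ⟨t, rfl⟩ := Nat.exists_eq_add_of_le' h1
        rw [← state_shift_update (K := K) x₀ u i v (by omega)]
        -- Feasibility of `v` says nothing about the initial state `x₁`; that case comes from
        -- feasibility of `u` at time 1.
        rcases Nat.eq_zero_or_pos t with rfl | ht
        · exact hX 1 le_rfl (by omega)
        · exact hv.2 t ht (by omega)
    have h1 := (hu i).2 _ hfeas
    have h2 := cost_cons_le_cost_shift hV hN x₀ u i v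
    have h3 := cost_eq_cost_shift hV hN x₀ u i
    linarith

/-- Open-loop input sequence generated by the feedback `K`. -/
def feedback (G : Game n m N p) (K : Fin N → Matrix (Fin m) (Fin n) ℝ) (T : ℕ) (x₀ : Vec n) :
    InputSeq N m T :=
  fun i t => K i *ᵥ (G.Abar K ^ (t : ℕ) *ᵥ x₀)

theorem state_feedback (x₀ : Vec n) {t : ℕ} (ht : t ≤ T) :
    G.state x₀ (G.feedback K T x₀) t = G.Abar K ^ t *ᵥ x₀ := by
  induction t with
  | zero => simp [state]
  | succ t ih =>
    have h := state_fin_succ (G := G) x₀ (G.feedback K T x₀) ⟨t, ht⟩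
    rw [h, ih (by omega), pow_succ', ← Matrix.mulVec_mulVec, Abar_mulVec]
    rfl

theorem shift_feedback (x₀ : Vec n) :
    G.shift K x₀ (G.feedback K (S + 1) x₀) = G.feedback K (S + 1) (G.Abar K *ᵥ x₀) := by
  ext1 i
  ext1 t
  have hstep (t : ℕ) : G.Abar K ^ (t + 1) *ᵥ x₀ = G.Abar K ^ t *ᵥ (G.Abar K *ᵥ x₀) := by
    rw [pow_succ, Matrix.mulVec_mulVec]
  refine Fin.lastCases ?_ (fun s => ?_) t
  · rw [shift_last, state_feedback x₀ le_rfl, feedback, hstep, Fin.val_last]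
  · rw [shift_castSucc, feedback, feedback, Fin.val_succ, hstep, Fin.val_castSucc]

theorem IsTerminalSet.pow_mem {Xf : Set (Vec n)} (hXf : G.IsTerminalSet K Xf) {x : Vec n}
    (hx : x ∈ Xf) (t : ℕ) : G.Abar K ^ t *ᵥ x ∈ Xf := by
  induction t with
  | zero => simpa using hx
  | succ t ih =>
    rw [pow_succ', ← Matrix.mulVec_mulVec]
    exact (hXf _ ih).2.2

/-- In a terminal set, the feedback `K` generates a solution of the finite-horizon problem. -/
theorem isSolution_feedback (hV : G.IsTerminalCost K Ph) {Xf : Set (Vec n)}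
    (hXf : G.IsTerminalSet K Xf) {x₀ : Vec n} (hx₀ : x₀ ∈ Xf) :
    G.IsSolution Ph x₀ (G.feedback K T x₀) := by
  intro i
  -- Telescoping `IsTerminalCost.le` along `y_t = Āᵗ x₀` bounds the cost of any deviation below by
  -- `V_i(x₀, x₀)`; `hvalue` shows that the feedback attains this bound.
  have hlower (v : Fin T → Vec m) (t : ℕ) (ht : t ≤ T) : terminalCost (Ph i) x₀ x₀ ≤
      ∑ s : Fin t, G.stageCost i (G.state x₀ (Function.update (G.feedback K T x₀) i v) s)
        (v (Fin.castLE ht s)) +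
      terminalCost (Ph i) (G.state x₀ (Function.update (G.feedback K T x₀) i v) t)
        (G.Abar K ^ t *ᵥ x₀) := by
    induction t with
    | zero => simp [state]
    | succ t ih =>
      have hs := state_fin_succ (G := G) x₀ (Function.update (G.feedback K T x₀) i v) ⟨t, ht⟩
      have h := hV.le i (G.state x₀ (Function.update (G.feedback K T x₀) i v) t)
        (G.Abar K ^ t *ᵥ x₀)
        (fun j => Function.update (G.feedback K T x₀) i v j ⟨t, ht⟩)
        (fun j hj => by rw [Function.update_of_ne hj]; rfl)
      simp only at hs
      rw [← hs, Function.update_self, Matrix.mulVec_mulVec, ← pow_succ'] at h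
      have h0 := ih (by omega)
      rw [Fin.sum_univ_castSucc, add_assoc]
      exact h0.trans (add_le_add_right h _)
  have hvalue (t : ℕ) : terminalCost (Ph i) x₀ x₀ =
      ∑ s ∈ Finset.range t, G.stageCost i (G.Abar K ^ s *ᵥ x₀) (K i *ᵥ (G.Abar K ^ s *ᵥ x₀)) +
      terminalCost (Ph i) (G.Abar K ^ t *ᵥ x₀) (G.Abar K ^ t *ᵥ x₀) := by
    induction t with
    | zero => simp
    | succ t ih =>
      rw [ih, ← hV.eq, Finset.sum_range_succ, add_assoc, pow_succ', ← Matrix.mulVec_mulVec]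
  refine ⟨⟨fun t => (hXf _ (hXf.pow_mem hx₀ t)).2.1 i, fun t _ ht => ?_⟩, fun v _ => ?_⟩
  · rw [Function.update_eq_self, state_feedback x₀ ht]
    exact (hXf _ (hXf.pow_mem hx₀ t)).1
  · have h := hlower v T le_rfl
    rw [hvalue T, ← Fin.sum_univ_eq_sum_range
      (fun s => G.stageCost i (G.Abar K ^ s *ᵥ x₀) (K i *ᵥ (G.Abar K ^ s *ᵥ x₀)))] at h
    rw [cost, cost, Function.update_eq_self, state_feedback x₀ le_rfl]
    refine le_trans (le_of_eq ?_) h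
    congr 1
    refine Finset.sum_congr rfl fun s _ => ?_
    rw [state_feedback x₀ s.2.le]
    rfl

end Trajectories

/-- The states whose trajectory under the feedback `K` is admissible at all times. -/
def maximalTerminalSet (G : Game n m N p) (K : Fin N → Matrix (Fin m) (Fin n) ℝ) : Set (Vec n) :=
  {x | ∀ t : ℕ, G.Abar K ^ t *ᵥ x ∈ G.X ∧
    G.InputAdmissible fun i => K i *ᵥ (G.Abar K ^ t *ᵥ x)}

theorem isTerminalSet_maximalTerminalSet : G.IsTerminalSet K (G.maximalTerminalSet K) := by
  intro x hx
  refine ⟨by simpa using (hx 0).1, by simpa using (hx 0).2, fun t => ?_⟩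
  have h := hx (t + 1)
  rwa [pow_succ, ← Matrix.mulVec_mulVec] at h

/-- With `‖Āᵗ x‖ ≤ c ‖x‖` for all `t`, orbits from the ball of radius `ε / c` stay in the `ε`-ball,
where all constraints hold. -/
theorem maximalTerminalSet_mem_nhds (hbasic : G.BasicAssumption) (hAbar : IsSchur (G.Abar K)) :
    G.maximalTerminalSet K ∈ 𝓝 0 := by
  obtain ⟨hX, hU, -⟩ := hbasic
  have hcont : Continuous fun (x : Vec n) (i : Fin N) => K i *ᵥ x := by fun_prop
  have h2 : ∀ᶠ x : Vec n in 𝓝 0, G.InputAdmissible fun i => K i *ᵥ x := by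
    refine hcont.continuousAt.eventually_mem (s := {w | G.InputAdmissible w}) ?_
    simp only [Matrix.mulVec_zero]
    exact mem_interior_iff_mem_nhds.1 hU
  have h1 : ∀ᶠ x : Vec n in 𝓝 0, x ∈ G.X := mem_interior_iff_mem_nhds.1 hX
  obtain ⟨ε, hε, hball⟩ := Metric.eventually_nhds_iff_ball.1 (h1.and h2)
  obtain ⟨c, hc, hbound⟩ := hAbar.exists_bound
  refine Metric.mem_nhds_iff.2 ⟨ε / c, by positivity, fun x hx t => hball _ ?_⟩
  rw [mem_ball_zero_iff] at hx ⊢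
  refine (hbound t x).trans_lt ?_
  rwa [lt_div_iff₀' hc] at hx

theorem closedLoop_eq_state {T : ℕ} (hT : 0 < T) (uFH : Vec n → InputSeq N m T) (x : Vec n) :
    G.closedLoop hT uFH x = G.state x (uFH x) 1 := by
  simp [closedLoop, state, hT]

end Game

/-! ### The receding-horizon closed loop. -/

namespace Game

variable {n m N S : ℕ} {p : Fin N → ℕ} {G : Game n m N p}
  {K : Fin N → Matrix (Fin m) (Fin n) ℝ}
  {Ph : Fin N → Matrix (Fin n ⊕ Fin n) (Fin n ⊕ Fin n) ℝ} {Xf : Set (Vec n)}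
  {uFH : Vec n → InputSeq N m (S + 1)} {hT : 0 < S + 1}

/-- At successors of states in the maximal terminal set, the selection is the linear feedback. -/
theorem closedLoop_of_maximalTerminalSet (hV : G.IsTerminalCost K Ph)
    (hshift : G.SelectsShifted Ph K uFH) {x : Vec n} (hx : x ∈ G.maximalTerminalSet K) :
    G.closedLoop hT uFH (G.Abar K *ᵥ x) = G.Abar K *ᵥ (G.Abar K *ᵥ x) := by
  have hO := isTerminalSet_maximalTerminalSet (G := G) (K := K)
  have h1 (z : Vec n) : G.state z (G.feedback K (S + 1) z) 1 = G.Abar K *ᵥ z := by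
    rw [state_feedback z (by omega), pow_one]
  have h := hshift x (hO x hx).1 (G.feedback K (S + 1) x) (isSolution_feedback hV hO hx)
  rw [h1, shift_feedback] at h
  rw [closedLoop_eq_state, h (isSolution_feedback hV hO (hO x hx).2.2), h1]

/-- Near the origin, the closed loop is the linear system `x⁺ = (A + ∑ i, B i K i) x`. -/
theorem eventually_iterate_closedLoop (hV : G.IsTerminalCost K Ph)
    (hshift : G.SelectsShifted Ph K uFH) (hbasic : G.BasicAssumption)
    (hAbar : IsSchur (G.Abar K)) (hunit : IsUnit (G.Abar K)) :
    ∀ᶠ x : Vec n in 𝓝 0, ∀ k : ℕ, (G.closedLoop hT uFH)^[k] x = G.Abar K ^ k *ᵥ x := by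
  have hcont : Continuous fun x : Vec n => (G.Abar K)⁻¹ *ᵥ x := by fun_prop
  have hmem : ∀ᶠ x : Vec n in 𝓝 0, (G.Abar K)⁻¹ *ᵥ x ∈ G.maximalTerminalSet K := by
    refine hcont.continuousAt.eventually_mem (s := G.maximalTerminalSet K) ?_
    rw [Matrix.mulVec_zero]
    exact maximalTerminalSet_mem_nhds hbasic hAbar
  filter_upwards [hmem] with x hx k
  induction k with
  | zero => simp
  | succ k ih =>
    -- Each point of the linear orbit is displayed as the successor of a state in the maximal
    -- terminal set, since shifted selection constrains `uFH` only at successors.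
    have hk : G.Abar K ^ k *ᵥ x = G.Abar K *ᵥ (G.Abar K ^ k *ᵥ ((G.Abar K)⁻¹ *ᵥ x)) := by
      rw [Matrix.mulVec_mulVec, Matrix.mulVec_mulVec, ← pow_succ', pow_succ,
        Matrix.mul_nonsing_inv_cancel_right _ _ ((Matrix.isUnit_iff_isUnit_det _).1 hunit)]
    rw [Function.iterate_succ_apply', ih, hk,
      closedLoop_of_maximalTerminalSet hV hshift (isTerminalSet_maximalTerminalSet.pow_mem hx k),
      ← hk, pow_succ', Matrix.mulVec_mulVec]

theorem selection_closedLoop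
    (hV : G.IsTerminalCost K Ph) (hN : 0 < N) (hXf : G.IsTerminalSet K Xf)
    (huFH : ∀ x ∈ G.reachableSet (S + 1) Ph Xf,
      G.IsSolution Ph x (uFH x) ∧ G.state x (uFH x) (S + 1) ∈ Xf)
    (hshift : G.SelectsShifted Ph K uFH)
    {x : Vec n} (hx : x ∈ G.reachableSet (S + 1) Ph Xf) :
    uFH (G.closedLoop hT uFH x) = G.shift K x (uFH x) := by
  obtain ⟨hsol, hend⟩ := huFH x hx
  rw [closedLoop_eq_state]
  exact hshift x hx.1 _ hsol (hsol.shift hV hN hXf hend)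

theorem closedLoop_mem_reachableSet
    (hV : G.IsTerminalCost K Ph) (hN : 0 < N) (hXf : G.IsTerminalSet K Xf)
    (huFH : ∀ x ∈ G.reachableSet (S + 1) Ph Xf,
      G.IsSolution Ph x (uFH x) ∧ G.state x (uFH x) (S + 1) ∈ Xf)
    {x : Vec n} (hx : x ∈ G.reachableSet (S + 1) Ph Xf) :
    G.closedLoop hT uFH x ∈ G.reachableSet (S + 1) Ph Xf := by
  obtain ⟨hsol, hend⟩ := huFH x hx
  rw [closedLoop_eq_state]
  refine ⟨?_, G.shift K x (uFH x), hsol.shift hV hN hXf hend, ?_⟩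
  · simpa using (hsol ⟨0, hN⟩).1.2 1 le_rfl (by omega)
  · rw [state_shift_last hN]
    exact (hXf _ hend).2.2

theorem iterate_closedLoop_mem_reachableSet
    (hV : G.IsTerminalCost K Ph) (hN : 0 < N) (hXf : G.IsTerminalSet K Xf)
    (huFH : ∀ x ∈ G.reachableSet (S + 1) Ph Xf,
      G.IsSolution Ph x (uFH x) ∧ G.state x (uFH x) (S + 1) ∈ Xf)
    {x : Vec n} (hx : x ∈ G.reachableSet (S + 1) Ph Xf) (k : ℕ) :
    (G.closedLoop hT uFH)^[k] x ∈ G.reachableSet (S + 1) Ph Xf := by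
  induction k with
  | zero => exact hx
  | succ k ih =>
    rw [Function.iterate_succ_apply']
    exact closedLoop_mem_reachableSet hV hN hXf huFH ih

/-- The closed loop follows the predicted trajectory over the horizon. -/
theorem iterate_closedLoop_eq_state
    (hV : G.IsTerminalCost K Ph) (hN : 0 < N) (hXf : G.IsTerminalSet K Xf)
    (huFH : ∀ x ∈ G.reachableSet (S + 1) Ph Xf,
      G.IsSolution Ph x (uFH x) ∧ G.state x (uFH x) (S + 1) ∈ Xf)
    (hshift : G.SelectsShifted Ph K uFH)
    {x : Vec n} (hx : x ∈ G.reachableSet (S + 1) Ph Xf) {t : ℕ}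
    (ht : t ≤ S + 1) : (G.closedLoop hT uFH)^[t] x = G.state x (uFH x) t := by
  induction t generalizing x with
  | zero => rfl
  | succ t ih =>
    rw [Function.iterate_succ_apply,
      ih (closedLoop_mem_reachableSet hV hN hXf huFH hx) (by omega),
      selection_closedLoop hV hN hXf huFH hshift hx, closedLoop_eq_state,
      state_shift hN x _ (by omega)]

/-- Each shift appends one step of `Ā` to the predicted trajectory. -/
theorem state_selection_iterate
    (hV : G.IsTerminalCost K Ph) (hN : 0 < N) (hXf : G.IsTerminalSet K Xf)
    (huFH : ∀ x ∈ G.reachableSet (S + 1) Ph Xf,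
      G.IsSolution Ph x (uFH x) ∧ G.state x (uFH x) (S + 1) ∈ Xf)
    (hshift : G.SelectsShifted Ph K uFH)
    {x : Vec n} (hx : x ∈ G.reachableSet (S + 1) Ph Xf) (k : ℕ) :
    G.state ((G.closedLoop hT uFH)^[k] x) (uFH ((G.closedLoop hT uFH)^[k] x)) (S + 1) =
      G.Abar K ^ k *ᵥ G.state x (uFH x) (S + 1) := by
  induction k with
  | zero => simp
  | succ k ih =>
    have hk := iterate_closedLoop_mem_reachableSet (hT := hT) hV hN hXf huFH hx k
    rw [Function.iterate_succ_apply', selection_closedLoop hV hN hXf huFH hshift hk,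
      closedLoop_eq_state, state_shift_last hN, ih, pow_succ', Matrix.mulVec_mulVec]

/-- The closed-loop state at time `k + T` is the terminal state predicted at time `k`, namely `Āᵏ
φ[T | x]`. -/
theorem tendsto_iterate_closedLoop
    (hV : G.IsTerminalCost K Ph) (hN : 0 < N) (hXf : G.IsTerminalSet K Xf)
    (huFH : ∀ x ∈ G.reachableSet (S + 1) Ph Xf,
      G.IsSolution Ph x (uFH x) ∧ G.state x (uFH x) (S + 1) ∈ Xf)
    (hshift : G.SelectsShifted Ph K uFH)
    (hAbar : IsSchur (G.Abar K)) {x : Vec n}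
    (hx : x ∈ G.reachableSet (S + 1) Ph Xf) :
    Tendsto (fun k : ℕ => (G.closedLoop hT uFH)^[k] x) atTop (𝓝 0) := by
  rw [← tendsto_add_atTop_iff_nat (S + 1)]
  refine (hAbar.tendsto_pow_mulVec (G.state x (uFH x) (S + 1))).congr fun k => ?_
  rw [add_comm k, Function.iterate_add_apply, iterate_closedLoop_eq_state hV hN hXf huFH hshift
    (iterate_closedLoop_mem_reachableSet hV hN hXf huFH hx k) le_rfl,
    state_selection_iterate hV hN hXf huFH hshift hx]

end Game

end OLNE

end

theorem mainTheorem2 {n m N T : ℕ} {p : Fin N → ℕ} (hN : 0 < N) (hT : 0 < T)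
    (G : OLNE.Game n m N p)
    (hbasic : G.BasicAssumption) (hprim : G.PrimitivesAssumption)
    (W : Submodule ℝ (Fin n ⊕ Fin N × Fin n → ℝ)) (hH : G.StructureAssumption W)
    (P : Fin N → Matrix (Fin n) (Fin n) ℝ) (K : Fin N → Matrix (Fin m) (Fin n) ℝ)
    (hPK : G.SolvesRiccati P K) (hPW : OLNE.Game.GraphIn P W)
    (Ph : Fin N → Matrix (Fin n ⊕ Fin n) (Fin n ⊕ Fin n) ℝ)
    (hPh : ∀ i, G.SolvesAugmentedRiccati K i (Ph i))
    (Xf : Set (OLNE.Vec n)) (hXf : G.IsTerminalSet K Xf)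
    (uFH : OLNE.Vec n → OLNE.InputSeq N m T)
    (huFH : ∀ x ∈ G.reachableSet T Ph Xf,
      G.IsSolution Ph x (uFH x) ∧ G.state x (uFH x) T ∈ Xf)
    (hshift : G.SelectsShifted Ph K uFH) :
    OLNE.IsAsymptoticallyStableWithRegion (G.closedLoop hT uFH) (G.reachableSet T Ph Xf) := by
  obtain ⟨S, rfl⟩ := Nat.exists_eq_add_of_le' (Nat.succ_le_of_lt hT)
  have hAbar : OLNE.IsSchur (G.Abar K) := hPK.isSchur_Abar hprim.1 hH hPW
  have hV : G.IsTerminalCost K Ph :=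
    OLNE.Game.isTerminalCost hbasic.2.2 (fun i => (hprim.2 i).2) hPK hAbar hPh
  obtain ⟨r, hr, hlin⟩ := Metric.eventually_nhds_iff_ball.1
    (OLNE.Game.eventually_iterate_closedLoop (hT := hT) hV hshift hbasic hAbar
      (hPK.isUnit_Abar hprim.1))
  simp only [mem_ball_zero_iff] at hlin
  refine ⟨?_, fun ε hε => ?_, ⟨r, hr, fun x hx => ?_⟩,
    fun x hx => OLNE.Game.closedLoop_mem_reachableSet hV hN hXf huFH hx,
    fun x hx => OLNE.Game.tendsto_iterate_closedLoop hV hN hXf huFH hshift hAbar hx⟩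
  · simpa using hlin 0 (by simpa using hr) 1
  · obtain ⟨c, hc, hbound⟩ := hAbar.exists_bound
    -- The radius `r` makes the orbit linear, and `ε / c` keeps the linear orbit below `ε`.
    refine ⟨min r (ε / c), by positivity, fun x hx k => ?_⟩
    rw [hlin x (hx.trans_le (min_le_left _ _)) k]
    exact (hbound k x).trans_lt ((lt_div_iff₀' hc).1 (hx.trans_le (min_le_right _ _)))
  · simpa only [hlin x hx] using hAbar.tendsto_pow_mulVec x
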